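/- Let $n, k \ge 0$ be integers, let $M$ be a matroid of rank $r$ on $[n]=\{1,\dots,n\}$ with rank function $r(\cdot)$, and let $S \subseteq [n]$ with complement $S^c = [n]\setminus S$. For a matroid $N$ on $[n]$ let $$Q(N)=\mathrm{conv}\{e_B : B \text{ a base of } N\}\subset\mathbb{R}^n,\qquad e_B=\sum_{b\in B}e_b,$$ be its matroid base polytope. Say that $H=\{x\in\mathbb{R}^n:\sum_{e\in S}x_e=k\}$ gives a hyperplane split of $Q(M)$ if there are matroids $M_1,M_2$ on $[n]$ such that $$Q(M_1)=Q(M)\cap\Big\{x:\sum_{e\in S}x_e\le k\Big\},\qquad Q(M_2)=Q(M)\cap\Big\{x:\sum_{e\in S}x_e\ge k\Big\}$$ (so that $Q(M)=Q(M_1)\cup Q(M_2)$), and $Q(M_1)\cap Q(M_2)$ is a proper face of both $Q(M_1)$ and $Q(M_2)$. Then $H$ gives a hyperplane split of $Q(M)$ if and only if the following two conditions hold: (i) $r(S)>k$ and $r(S^c)>r-k$; (ii) if $I_1$ and $I_2$ are $k$-element independent subsets of $S$ such that $(M/I_1)|_{S^c}$ and $(M/I_2)|_{S^c}$ both have rank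 $r-k$, then $(M/I_1)|_{S^c}=(M/I_2)|_{S^c}$. -/

import Mathlib

open scoped Matroid

/-- The vector `e_B = ∑_{b ∈ B} e_b` of `ℝⁿ`: its coordinates are `1` on `B` and `0` off `B`. -/
noncomputable def indicatorVector {n : ℕ} (B : Set (Fin n)) : Fin n → ℝ :=
  B.indicator (fun _ => 1)

/-- The matroid base polytope `Q(M) = conv {e_B : B a base of M}`. -/
noncomputable def basePolytope {n : ℕ} (M : Matroid (Fin n)) : Set (Fin n → ℝ) :=
  convexHull ℝ (indicatorVector '' {B | M.IsBase B})

/-- `F` is a proper face of the polytope `P`: the set of maximizers over `P` of some linear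
functional (or the empty face), different from `P`. -/
def IsProperFace {n : ℕ} (P F : Set (Fin n → ℝ)) : Prop :=
  IsExposed ℝ P F ∧ F ≠ P

/-- `Q(M) = Q(M₁) ∪ Q(M₂)` is a hyperplane split of `Q(M)`: `M₁` and `M₂` are matroids on all of
`[n]`, and `Q(M₁) ∩ Q(M₂)` is a proper face of both `Q(M₁)` and `Q(M₂)`. -/
structure IsHyperplaneSplit {n : ℕ} (M M₁ M₂ : Matroid (Fin n)) : Prop where
  ground_left : M₁.E = Set.univ
  ground_right : M₂.E = Set.univ
  union_eq : basePolytope M = basePolytope M₁ ∪ basePolytope M₂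
  face_left : IsProperFace (basePolytope M₁) (basePolytope M₁ ∩ basePolytope M₂)
  face_right : IsProperFace (basePolytope M₂) (basePolytope M₁ ∩ basePolytope M₂)

/-- The hyperplane `∑_{e ∈ S} x_e = k` gives a hyperplane split of `Q(M)`: there is a hyperplane
split of `Q(M)` whose two pieces are the parts of `Q(M)` on the two sides of the hyperplane. -/
def GivesHyperplaneSplit {n : ℕ} (M : Matroid (Fin n)) (S : Finset (Fin n)) (k : ℕ) : Prop :=
  ∃ M₁ M₂ : Matroid (Fin n), IsHyperplaneSplit M M₁ M₂ ∧
    basePolytope M₁ = basePolytope M ∩ {x | ∑ e ∈ S, x e ≤ (k : ℝ)} ∧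
    basePolytope M₂ = basePolytope M ∩ {x | (k : ℝ) ≤ ∑ e ∈ S, x e}

/-! ### Exchange arguments and level sets of bases -/

namespace Matroid

open Set

/-! Call |B ∩ S| the level of a base B. Condition (i) says that bases exist strictly above and
strictly below level k; condition (ii) says that the level-k bases form a product
(`isProductAtLevel_iff`). Necessity: an indicator vector lies in Q(M₁) only if its set is a base of
M₁, so the bases of M₁ are those of M of level at most k, and `isProductAtLevel_of_isBase_iff`
yields the product. Properness of the common face yields (i). Sufficiency: the product property
gives the exchange axiom on each side (`exchangeProperty_ncard_inter_le`). It remains that the cut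
creates no new vertices: a point of Q(M) on H is a combination of level-k bases
(`mem_convexHull_of_coordSum_eq`). This needs only bases on both sides, and rests on symmetric
exchange changing the level by at most one. -/

theorem IsBase.symm_exchange {α : Type*} {M : Matroid α} {B B' : Set α} {i : α}
    (hB : M.IsBase B) (hB' : M.IsBase B') (hi : i ∈ B \ B') :
    ∃ j ∈ B' \ B, M.IsBase (insert j (B \ {i})) ∧ M.IsBase (insert i (B' \ {j})) := by
  have hiE := hB.subset_ground hi.1
  have hC := hB'.fundCircuit_isCircuit hiE hi.2
  have hex : ∃ j ∈ M.fundCircuit i B', j ≠ i ∧ j ∉ M.closure (B \ {i}) := by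
    by_contra! h
    have hi' := hC.mem_closure_sdiff_singleton_of_mem (M.mem_fundCircuit i B')
    exact hB.indep.notMem_closure_sdiff_of_mem hi.1
      (M.closure_subset_closure_of_subset_closure (fun j hj => h j hj.1 hj.2) hi')
  obtain ⟨j, hj, hji, hjc⟩ := hex
  have hjB' : j ∈ B' := ((M.fundCircuit_subset_insert i B') hj).resolve_left hji
  have hjE := hB'.subset_ground hjB'
  have hjB : j ∉ B := fun h => hjc (M.mem_closure_of_mem' ⟨h, hji⟩ hjE)
  refine ⟨j, ⟨hjB', hjB⟩, hB.exchange_base_of_notMem_closure hi.1 hjc hjE, ?_⟩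
  have h := (hB'.indep.mem_fundCircuit_iff (by rwa [hB'.closure_eq]) hi.2).1 hj
  rw [← insert_sdiff_singleton_comm hji.symm] at h
  exact hB'.exchange_isBase_of_indep hi.2 h

/-- A modular weight on sets, as far as symmetric exchange sees it. -/
def ExchangeModular {α : Type*} (w : Set α → ℝ) : Prop :=
  ∀ ⦃B B' : Set α⦄ ⦃i j : α⦄, i ∈ B \ B' → j ∈ B' \ B →
    w (insert j (B \ {i})) + w (insert i (B' \ {j})) = w B + w B'

/-- Move B towards the maximizer G by symmetric exchange. The partner base obtained from G weighs at
most `w G`, so by modularity the base obtained from B weighs at least `w B`. Levels drop by at most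
one per move, so k is not skipped. Integer levels allow negation, which serves the opposite side. -/
theorem exists_isBase_level_eq_of_forall_le {α : Type*} [Finite α] {M : Matroid α}
    {w : Set α → ℝ} (hw : ExchangeModular w) {l : Set α → ℤ} {k : ℤ}
    (hl : ∀ (B : Set α) (i j : α), l B ≤ l (insert j (B \ {i})) + 1) {G : Set α}
    (hG : M.IsBase G) (hGk : l G < k) (hmax : ∀ B, M.IsBase B → w B ≤ w G) (B : Set α)
    (hB : M.IsBase B) (hBk : k ≤ l B) : ∃ C, M.IsBase C ∧ l C = k ∧ w B ≤ w C := by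
  induction hn : (G \ B).ncard using Nat.strong_induction_on generalizing B with
  | _ n ih =>
    obtain hk | hk := hBk.eq_or_lt
    · exact ⟨B, hB, hk.symm, le_rfl⟩
    have hne : ¬ B ⊆ G := fun h => by
      have := hB.eq_of_subset_isBase hG h
      subst this
      omega
    obtain ⟨i, hiB, hiG⟩ := not_subset.1 hne
    obtain ⟨j, hj, h₁, h₂⟩ := hB.symm_exchange hG ⟨hiB, hiG⟩
    have hmod := hw ⟨hiB, hiG⟩ hj
    have hle := hmax _ h₂
    have hlt : (G \ insert j (B \ {i})).ncard < n := by
      rw [← hn]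
      refine ncard_lt_ncard ⟨fun x hx => ⟨hx.1, fun hxB => hx.2 (Or.inr ⟨hxB, ?_⟩)⟩,
        fun h => (h hj).2 (Or.inl rfl)⟩
      rintro rfl
      exact hiG hx.1
    obtain ⟨C, hC, hCk, hCw⟩ := ih _ hlt _ h₁ (by have := hl B i j; omega) rfl
    exact ⟨C, hC, hCk, by linarith⟩

theorem ncard_insert_sdiff_inter_le {α : Type*} [Finite α] (S B : Set α) (i j : α) :
    (insert j (B \ {i}) ∩ S).ncard ≤ (B ∩ S).ncard + 1 := by
  refine (ncard_le_ncard (t := insert j (B ∩ S)) ?_).trans (ncard_insert_le _ _)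
  rintro x ⟨rfl | hx, hxS⟩
  · exact Or.inl rfl
  · exact Or.inr ⟨hx.1, hxS⟩

theorem ncard_inter_le_insert_sdiff {α : Type*} [Finite α] (S B : Set α) (i j : α) :
    (B ∩ S).ncard ≤ (insert j (B \ {i}) ∩ S).ncard + 1 := by
  refine (ncard_le_ncard (t := insert i (insert j (B \ {i}) ∩ S)) ?_).trans (ncard_insert_le _ _)
  rintro x ⟨hx, hxS⟩
  by_cases h : x = i
  · exact Or.inl h
  · exact Or.inr ⟨Or.inr ⟨hx, h⟩, hxS⟩

theorem exists_isBase_ncard_inter_eq {α : Type*} [Finite α] {M : Matroid α}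
    {w : Set α → ℝ} (hw : ExchangeModular w) {S : Set α} {k : ℕ} {B B' : Set α}
    (hB : M.IsBase B) (hB' : M.IsBase B') (hk : k ≤ (B ∩ S).ncard) (hk' : (B' ∩ S).ncard ≤ k) :
    ∃ C, M.IsBase C ∧ (C ∩ S).ncard = k ∧ min (w B) (w B') ≤ w C := by
  obtain ⟨G, hG, hmax⟩ := (Set.toFinite {B | M.IsBase B}).exists_maximalFor w _ ⟨B, hB⟩
  replace hmax : ∀ B, M.IsBase B → w B ≤ w G := fun C hC =>
    (le_total (w C) (w G)).elim id fun h => hmax hC h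
  obtain h | h | h := lt_trichotomy (G ∩ S).ncard k
  · obtain ⟨C, hC, hCk, hCw⟩ := exists_isBase_level_eq_of_forall_le hw (k := k)
      (l := fun B => ((B ∩ S).ncard : ℤ))
      (fun B i j => by have := ncard_inter_le_insert_sdiff S B i j; omega) hG
      (by simpa using h) hmax B hB (by simpa using hk)
    exact ⟨C, hC, by simpa using hCk, (min_le_left _ _).trans hCw⟩
  · exact ⟨G, hG, h, (min_le_left _ _).trans (hmax _ hB)⟩
  · obtain ⟨C, hC, hCk, hCw⟩ := exists_isBase_level_eq_of_forall_le hw (k := -k)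
      (l := fun B => -((B ∩ S).ncard : ℤ))
      (fun B i j => by have := ncard_insert_sdiff_inter_le S B i j; omega) hG
      (by simpa using h) hmax B' hB' (by simpa using hk')
    exact ⟨C, hC, by simpa using hCk, (min_le_right _ _).trans hCw⟩

theorem Indep.exists_indep_superset_encard_eq {α : Type*} {M : Matroid α} {I J : Set α}
    (hI : M.Indep I) (hJ : M.Indep J) (h : I.encard ≤ J.encard) :
    ∃ K, M.Indep K ∧ I ⊆ K ∧ K ⊆ I ∪ J ∧ K.encard = J.encard := by
  obtain ⟨K, hK, hIK⟩ := hI.subset_isBasis_of_subset (X := I ∪ J) subset_union_left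
    (union_subset hI.subset_ground hJ.subset_ground)
  have hJK : J.encard ≤ K.encard := by
    rw [hK.encard_eq_eRk]
    exact hJ.encard_le_eRk_of_subset subset_union_right
  obtain ⟨L, hIL, hLK, hL⟩ := exists_superset_subset_encard_eq hIK h hJK
  exact ⟨L, hK.indep.subset hLK, hIL, hLK.trans hK.subset, hL⟩

/-- If the bases meeting `S` in exactly `k` elements form a product, then the bases meeting `S`
in at most `k` elements satisfy the exchange property. -/
theorem exchangeProperty_ncard_inter_le {α : Type*} [Finite α] {M : Matroid α} {S : Set α} {k : ℕ}
    (hprod : ∀ A B, M.IsBase A → M.IsBase B → (A ∩ S).ncard = k → (B ∩ S).ncard = k →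
      M.IsBase (A ∩ S ∪ B \ S)) :
    ExchangeProperty (fun B => M.IsBase B ∧ (B ∩ S).ncard ≤ k) := by
  rintro A B ⟨hA, hAk⟩ ⟨hB, hBk⟩ x hx
  obtain ⟨y, hy, hyA⟩ := hA.exchange hB hx
  -- Any exchange in M respects the bound in the first two cases; in the last one the incoming
  -- element must avoid S.
  have hcase : x ∈ S ∨ (A ∩ S).ncard < k ∨ (x ∉ S ∧ (A ∩ S).ncard = k) := by
    by_cases x ∈ S <;> [left; right] <;> grind
  obtain hxS | hlt | ⟨hxS, hAk⟩ := hcase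
  · refine ⟨y, hy, hyA, le_trans ?_ hAk⟩
    calc (insert y (A \ {x}) ∩ S).ncard ≤ (insert y ((A ∩ S) \ {x})).ncard := by
          refine ncard_le_ncard ?_
          rintro z ⟨rfl | hz, hzS⟩
          · exact Or.inl rfl
          · exact Or.inr ⟨⟨hz.1, hzS⟩, hz.2⟩
      _ ≤ ((A ∩ S) \ {x}).ncard + 1 := ncard_insert_le _ _
      _ = (A ∩ S).ncard := ncard_sdiff_singleton_add_one ⟨hx.1, hxS⟩
  · exact ⟨y, hy, hyA, (ncard_insert_sdiff_inter_le S A x y).trans hlt⟩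
  -- Lift B to a level-k base B' whose part outside S still lies in B, so that the product property
  -- applies to A and B'.
  obtain ⟨K, hK, hBK, hKS, hKk⟩ := (hB.indep.inter_right S).exists_indep_superset_encard_eq
    (hA.indep.inter_right S) (by
      rw [← (toFinite (B ∩ S)).cast_ncard_eq, ← (toFinite (A ∩ S)).cast_ncard_eq, hAk]
      exact_mod_cast hBk)
  obtain ⟨B', hB', hKB', hB'K⟩ := hK.exists_isBase_subset_union_isBase hB
  have hKS' : K ⊆ S := hKS.trans (union_subset inter_subset_right inter_subset_right)
  have hB'S : B' ∩ S = K := by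
    refine Subset.antisymm ?_ (subset_inter hKB' hKS')
    rintro z ⟨hz, hzS⟩
    exact (hB'K hz).elim id fun h => hBK ⟨h, hzS⟩
  have hbase := hprod A B' hA hB' hAk (by rw [hB'S, ← hAk, ncard_def, ncard_def, hKk])
  -- Otherwise A \ {x} would span the product base, as x ∉ S leaves A ∩ S intact.
  have hex : ∃ z ∈ B \ S, z ∉ M.closure (A \ {x}) := by
    by_contra! h
    have hsub : A ∩ S ∪ B' \ S ⊆ M.closure (A \ {x}) := by
      rintro z (hz | hz)
      · refine M.mem_closure_of_mem' ⟨hz.1, ?_⟩ (hA.subset_ground hz.1)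
        rintro rfl
        exact hxS hz.2
      · exact h z ⟨(hB'K hz.1).resolve_left fun hzK => hz.2 (hKS' hzK), hz.2⟩
    have hcl := M.closure_subset_closure_of_subset_closure hsub
    rw [hbase.closure_eq] at hcl
    exact hA.indep.notMem_closure_sdiff_of_mem hx.1 (hcl (hA.subset_ground hx.1))
  obtain ⟨z, hz, hzc⟩ := hex
  have hzE := hB.subset_ground hz.1
  have hzx : z ≠ x := by
    rintro rfl
    exact hx.2 hz.1
  refine ⟨z, ⟨hz.1, fun hzA => hzc (M.mem_closure_of_mem' ⟨hzA, hzx⟩ hzE)⟩,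
    hA.exchange_base_of_notMem_closure hx.1 hzc hzE, ?_⟩
  rw [← hAk]
  refine ncard_le_ncard ?_
  rintro u ⟨rfl | hu, huS⟩
  · exact absurd huS hz.2
  · exact ⟨hu.1, huS⟩

theorem Indep.isBase_of_eRank_le {α : Type*} [Finite α] {M : Matroid α} {I : Set α}
    (hI : M.Indep I) (h : M.eRank ≤ I.encard) : M.IsBase I :=
  hI.isBase_of_eRk_ge (toFinite I) (by rwa [hI.eRk_eq_encard])

theorem restrict_contract_indep_iff {α : Type*} {M : Matroid α} {S I J : Set α} (hI : M.Indep I)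
    (hIS : I ⊆ S) : ((M ／ I) ↾ Sᶜ).Indep J ↔ M.Indep (J ∪ I) ∧ J ⊆ Sᶜ := by
  rw [restrict_indep_iff, hI.contract_indep_iff]
  exact ⟨fun h => ⟨h.1.2, h.2⟩,
    fun h => ⟨⟨disjoint_of_subset h.2 hIS disjoint_compl_left, h.1⟩, h.2⟩⟩

/-- The rank equation ensures that a base of the minor completes I to a full base of M. -/
theorem restrict_contract_isBase_iff {α : Type*} [Finite α] {M : Matroid α} {S I J : Set α}
    (hI : M.Indep I) (hIS : I ⊆ S) (hr : ((M ／ I) ↾ Sᶜ).eRank + I.encard = M.eRank) :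
    ((M ／ I) ↾ Sᶜ).IsBase J ↔ M.IsBase (J ∪ I) ∧ J ⊆ Sᶜ := by
  refine ⟨fun h => ?_, fun ⟨h, hJ⟩ => ?_⟩
  · have h' := (restrict_contract_indep_iff hI hIS).1 h.indep
    refine ⟨h'.1.isBase_of_eRank_le ?_, h'.2⟩
    rw [encard_union_eq (disjoint_of_subset h'.2 hIS disjoint_compl_left), h.encard_eq_eRank, hr]
  · have h' := (restrict_contract_indep_iff hI hIS).2 ⟨h.indep, hJ⟩
    refine h'.isBase_of_eRank_le ?_
    have h₂ := h.encard_eq_eRank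
    rw [encard_union_eq (disjoint_of_subset hJ hIS disjoint_compl_left), ← hr] at h₂
    exact (WithTop.add_right_cancel (toFinite I).encard_lt_top.ne h₂).ge

theorem IsBase.eRank_restrict_contract {α : Type*} [Finite α] {M : Matroid α} {S I J : Set α}
    (hIS : I ⊆ S) (hJ : J ⊆ Sᶜ) (h : M.IsBase (J ∪ I)) :
    ((M ／ I) ↾ Sᶜ).eRank + I.encard = M.eRank := by
  have hI : M.Indep I := h.indep.subset subset_union_right
  obtain ⟨K, hK⟩ := ((M ／ I) ↾ Sᶜ).exists_isBase
  have hK' := (restrict_contract_indep_iff hI hIS).1 hK.indep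
  have hJ' := ((restrict_contract_indep_iff hI hIS).2 ⟨h.indep, hJ⟩).encard_le_eRank
  apply le_antisymm
  · rw [← hK.encard_eq_eRank,
      ← encard_union_eq (disjoint_of_subset hK'.2 hIS disjoint_compl_left)]
    exact hK'.1.encard_le_eRank
  · rw [← h.encard_eq_eRank, encard_union_eq (disjoint_of_subset hJ hIS disjoint_compl_left)]
    gcongr

end Matroid

open Set

/-! ### Convexity and the slice of the base polytope -/

/-- A segment from a ∈ conv A to b ∈ conv B through x meets the slice in a point of conv A, and x
lies between a and that point. -/
theorem mem_convexHull_of_forall_mem_slice {E : Type*} [AddCommGroup E] [Module ℝ E]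
    {A B : Set E} (hA : A.Nonempty) (hB : B.Nonempty) (f : E →ₗ[ℝ] ℝ) (c : ℝ)
    (hAc : ∀ a ∈ A, f a ≤ c) (hBc : ∀ b ∈ B, c ≤ f b)
    (hslice : ∀ z ∈ convexHull ℝ (A ∪ B), f z = c → z ∈ convexHull ℝ A)
    {x : E} (hx : x ∈ convexHull ℝ (A ∪ B)) (hxc : f x ≤ c) : x ∈ convexHull ℝ A := by
  have hx' := hx
  rw [convexHull_union hA hB, mem_convexJoin] at hx'
  obtain ⟨a, ha, b, hb, hxab⟩ := hx'
  have hfa : f a ≤ c := convexHull_min hAc (convex_halfSpace_le f.isLinear c) ha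
  have hfb : c ≤ f b := convexHull_min hBc (convex_halfSpace_ge f.isLinear c) hb
  rw [segment_eq_image'] at hxab
  obtain ⟨s, ⟨hs₀, hs₁⟩, rfl⟩ := hxab
  simp only [map_add, map_smul, map_sub, smul_eq_mul] at hxc
  obtain hab | hab := (hfa.trans hfb).eq_or_lt
  · refine hslice _ hx ?_
    simp only [map_add, map_smul, map_sub, smul_eq_mul]
    rw [← hab, sub_self, mul_zero, add_zero]
    linarith
  have hd : 0 < f b - f a := sub_pos.2 hab
  set t := (c - f a) / (f b - f a) with ht
  have htd : t * (f b - f a) = c - f a := div_mul_cancel₀ _ hd.ne'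
  have ht₀ : 0 ≤ t := div_nonneg (by linarith) hd.le
  have ht₁ : t ≤ 1 := (div_le_one hd).2 (by linarith)
  have hst : s ≤ t := (le_div_iff₀ hd).2 (by linarith)
  have hz : a + t • (b - a) ∈ convexHull ℝ A := by
    refine hslice _ ?_ ?_
    · refine (convex_convexHull ℝ _).add_smul_sub_mem ?_ ?_ ⟨ht₀, ht₁⟩
      · exact convexHull_mono subset_union_left ha
      · exact convexHull_mono subset_union_right hb
    · simp only [map_add, map_smul, map_sub, smul_eq_mul, htd]
      ring
  obtain h0 | h0 := ht₀.eq_or_lt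
  · have : s = 0 := by linarith
    simpa [this] using ha
  have := (convex_convexHull ℝ A).add_smul_sub_mem ha hz
    (t := s / t) ⟨div_nonneg hs₀ ht₀, (div_le_one h0).2 hst⟩
  rwa [add_sub_cancel_left, smul_smul, div_mul_cancel₀ _ h0.ne'] at this

theorem le_of_mem_convexHull_image {ι E : Type*} [AddCommGroup E] [Module ℝ E] {v : ι → E}
    {s : Set ι} (f : E →ₗ[ℝ] ℝ) {c : ℝ} (h : ∀ i ∈ s, f (v i) ≤ c) {x : E}
    (hx : x ∈ convexHull ℝ (v '' s)) : f x ≤ c :=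
  convexHull_min (by rintro _ ⟨i, hi, rfl⟩; exact h i hi) (convex_halfSpace_le f.isLinear c) hx

theorem ge_of_mem_convexHull_image {ι E : Type*} [AddCommGroup E] [Module ℝ E] {v : ι → E}
    {s : Set ι} (f : E →ₗ[ℝ] ℝ) {c : ℝ} (h : ∀ i ∈ s, c ≤ f (v i)) {x : E}
    (hx : x ∈ convexHull ℝ (v '' s)) : c ≤ f x :=
  convexHull_min (by rintro _ ⟨i, hi, rfl⟩; exact h i hi) (convex_halfSpace_ge f.isLinear c) hx

/-- The linear functional `x ↦ ∑_{e ∈ S} x_e`. -/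
def coordSum {n : ℕ} (S : Finset (Fin n)) : (Fin n → ℝ) →ₗ[ℝ] ℝ :=
  ∑ e ∈ S, LinearMap.proj e

theorem coordSum_apply {n : ℕ} (S : Finset (Fin n)) (x : Fin n → ℝ) :
    coordSum S x = ∑ e ∈ S, x e := by
  simp [coordSum]

theorem coordSum_indicatorVector {n : ℕ} (S : Finset (Fin n)) (B : Set (Fin n)) :
    coordSum S (indicatorVector B) = ((B ∩ S).ncard : ℝ) := by
  classical
  have h : B ∩ (S : Set (Fin n)) = ((S.filter (· ∈ B) : Finset (Fin n)) : Set (Fin n)) := by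
    ext e
    simp [and_comm]
  rw [coordSum_apply, h, ncard_coe_finset]
  simp [indicatorVector, indicator_apply]

theorem indicatorVector_insert_sdiff {n : ℕ} {B : Set (Fin n)} {i j : Fin n} (hi : i ∈ B)
    (hj : j ∉ B) : indicatorVector (insert j (B \ {i})) =
      indicatorVector B - Pi.single i 1 + Pi.single j 1 := by
  classical
  funext e
  simp only [indicatorVector, indicator_apply, Pi.add_apply, Pi.sub_apply, Pi.single_apply,
    mem_insert_iff, mem_sdiff, mem_singleton_iff]
  by_cases h₁ : e = j <;> by_cases h₂ : e = i <;> by_cases h₃ : e ∈ B <;> grind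

theorem exchangeModular_indicatorVector {n : ℕ} (f : (Fin n → ℝ) →ₗ[ℝ] ℝ) :
    Matroid.ExchangeModular fun B : Set (Fin n) => f (indicatorVector B) := by
  intro B B' i j hi hj
  simp only [indicatorVector_insert_sdiff hi.1 hj.2, indicatorVector_insert_sdiff hj.1 hi.2,
    map_add, map_sub]
  ring

/-- The functional with coefficient -1 on B and 1 off B exceeds its value at B by |C ∆ B| ≥ 1 at any
other C. -/
theorem mem_of_indicatorVector_mem_convexHull {n : ℕ} {s : Set (Set (Fin n))} {B : Set (Fin n)}
    (h : indicatorVector B ∈ convexHull ℝ (indicatorVector '' s)) : B ∈ s := by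
  classical
  by_contra hB
  let f : (Fin n → ℝ) →ₗ[ℝ] ℝ := ∑ e, (if e ∈ B then (-1 : ℝ) else 1) • LinearMap.proj e
  have hf : ∀ x, f x = ∑ e, (if e ∈ B then (-1 : ℝ) else 1) * x e := fun x => by
    simp only [f, LinearMap.sum_apply, LinearMap.smul_apply, LinearMap.proj_apply, smul_eq_mul]
  have key : ∀ C ∈ s, f (indicatorVector B) + 1 ≤ f (indicatorVector C) := by
    intro C hC
    have hne : C ≠ B := by
      rintro rfl
      exact hB hC
    obtain ⟨e, he⟩ : ∃ e, ¬ (e ∈ C ↔ e ∈ B) := by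
      by_contra! h'
      exact hne (Set.ext h')
    have hterm : ∀ a, 0 ≤ (if a ∈ B then (-1 : ℝ) else 1) *
        (indicatorVector C a - indicatorVector B a) := by
      intro a
      by_cases h₁ : a ∈ B <;> by_cases h₂ : a ∈ C <;> simp [indicatorVector, h₁, h₂]
    have hone : (if e ∈ B then (-1 : ℝ) else 1) *
        (indicatorVector C e - indicatorVector B e) = 1 := by
      by_cases h₁ : e ∈ B <;> by_cases h₂ : e ∈ C <;> simp_all [indicatorVector]
    have := Finset.single_le_sum (fun a _ => hterm a) (Finset.mem_univ e)
    rw [hone] at this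
    simp only [mul_sub, Finset.sum_sub_distrib, ← hf] at this
    linarith
  have := ge_of_mem_convexHull_image f key h
  linarith

/-- Lagrange duality: if f < u at the level-k bases, some multiplier m makes f - m(level - k) ≤ u at
every base, hence f ≤ u on the slice, against separation of x. -/
theorem mem_convexHull_of_coordSum_eq {n : ℕ} {M : Matroid (Fin n)} {S : Finset (Fin n)} {k : ℕ}
    {L U : Set (Fin n)} (hL : M.IsBase L) (hLk : (L ∩ S).ncard < k)
    (hU : M.IsBase U) (hUk : k < (U ∩ S).ncard) {x : Fin n → ℝ} (hx : x ∈ basePolytope M)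
    (hxk : coordSum S x = k) :
    x ∈ convexHull ℝ (indicatorVector '' {B | M.IsBase B ∧ (B ∩ S).ncard = k}) := by
  by_contra hnot
  obtain ⟨f, u, hfu, hux⟩ := geometric_hahn_banach_closed_point (convex_convexHull ℝ _)
    (((toFinite {B | M.IsBase B ∧ (B ∩ (S : Set (Fin n))).ncard = k}).image
      indicatorVector).isClosed_convexHull ℝ) hnot
  replace hfu : ∀ B, M.IsBase B → (B ∩ (S : Set (Fin n))).ncard = k → f (indicatorVector B) < u :=
    fun B hB hBk => hfu _ (subset_convexHull ℝ _ ⟨B, ⟨hB, hBk⟩, rfl⟩)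
  let c : Set (Fin n) → ℝ := fun B => f (indicatorVector B)
  let d : Set (Fin n) → ℝ := fun B => ((B ∩ S).ncard : ℝ) - k
  have cross : ∀ B B', M.IsBase B → M.IsBase B' → 0 < d B → d B' < 0 →
      (c B - u) / d B ≤ (c B' - u) / d B' := by
    -- With m the slope between B and B', the tilted weight f - m·level agrees on both, and a
    -- level-k base does at least as well.
    intro B B' hB hB' hd hd'
    set m : ℝ := (c B - c B') / (d B - d B') with hm
    have hmd : m * (d B - d B') = c B - c B' := div_mul_cancel₀ _ (by linarith)
    obtain ⟨C, hC, hCk, hCw⟩ := Matroid.exists_isBase_ncard_inter_eq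
      (exchangeModular_indicatorVector (f.toLinearMap - m • coordSum S)) (S := S) (k := k) hB hB'
      (by have : (k : ℝ) ≤ (B ∩ S).ncard := by simp only [d] at hd; linarith
          exact_mod_cast this)
      (by have : ((B' ∩ S).ncard : ℝ) ≤ k := by simp only [d] at hd'; linarith
          exact_mod_cast this)
    have hCu := hfu C hC hCk
    simp only [LinearMap.sub_apply, LinearMap.smul_apply, coordSum_indicatorVector, hCk,
      smul_eq_mul, ContinuousLinearMap.coe_coe] at hCw
    have e₁ : f (indicatorVector B) - m * ((B ∩ S).ncard : ℝ) = c B - m * d B - m * k := by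
      simp only [c, d]; ring
    have e₂ : f (indicatorVector B') - m * ((B' ∩ S).ncard : ℝ) = c B - m * d B - m * k := by
      have : c B - m * d B = c B' - m * d B' := by linarith
      rw [this]; simp only [c, d]; ring
    rw [e₁, e₂, min_self] at hCw
    have h₁ : c B - u ≤ m * d B := by linarith
    have h₂ : c B' - u ≤ m * d B' := by linarith
    exact ((div_le_iff₀ hd).2 h₁).trans ((le_div_iff_of_neg hd').2 h₂)
  obtain ⟨m, hmU, hmL⟩ := exists_between_of_forall_le
    (s := (fun B => (c B - u) / d B) '' {B | M.IsBase B ∧ 0 < d B})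
    (t := (fun B => (c B - u) / d B) '' {B | M.IsBase B ∧ d B < 0})
    ⟨_, U, ⟨hU, sub_pos.2 (by exact_mod_cast hUk)⟩, rfl⟩
    ⟨_, L, ⟨hL, sub_neg.2 (by exact_mod_cast hLk)⟩, rfl⟩
    (by rintro _ ⟨B, hB, rfl⟩ _ ⟨B', hB', rfl⟩; exact cross B B' hB.1 hB'.1 hB.2 hB'.2)
  have hall : ∀ B, M.IsBase B → c B - m * d B ≤ u := by
    intro B hB
    obtain h | h | h := lt_trichotomy (d B) 0
    · have := (le_div_iff_of_neg h).1 (hmL ⟨B, ⟨hB, h⟩, rfl⟩)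
      linarith
    · rw [h, mul_zero, sub_zero]
      refine (hfu B hB ?_).le
      have : ((B ∩ (S : Set (Fin n))).ncard : ℝ) = k := sub_eq_zero.1 h
      exact_mod_cast this
    · have := (div_le_iff₀ h).1 (hmU ⟨B, ⟨hB, h⟩, rfl⟩)
      linarith
  have := le_of_mem_convexHull_image (f.toLinearMap - m • coordSum S) (c := u - m * k)
    (fun B hB => by
      have := hall B hB
      simp only [c, d] at this
      simp only [LinearMap.sub_apply, LinearMap.smul_apply, coordSum_indicatorVector,
        smul_eq_mul, ContinuousLinearMap.coe_coe]
      linarith) hx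
  simp only [LinearMap.sub_apply, LinearMap.smul_apply, hxk, smul_eq_mul,
    ContinuousLinearMap.coe_coe] at this
  linarith

theorem basePolytope_inter_le_eq {n : ℕ} {M : Matroid (Fin n)} {S : Finset (Fin n)} {k : ℕ}
    {L U : Set (Fin n)} (hL : M.IsBase L) (hLk : (L ∩ S).ncard < k)
    (hU : M.IsBase U) (hUk : k < (U ∩ S).ncard) :
    convexHull ℝ (indicatorVector '' {B | M.IsBase B ∧ (B ∩ S).ncard ≤ k}) =
      basePolytope M ∩ {x | ∑ e ∈ S, x e ≤ (k : ℝ)} := by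
  have hunion : indicatorVector '' {B | M.IsBase B} =
      indicatorVector '' {B | M.IsBase B ∧ (B ∩ S).ncard ≤ k} ∪
      indicatorVector '' {B | M.IsBase B ∧ k ≤ (B ∩ S).ncard} := by
    rw [← image_union]
    congr 1
    ext B
    have := le_total (B ∩ (S : Set (Fin n))).ncard k
    simp only [mem_ofPred_eq, mem_union]
    tauto
  refine Subset.antisymm (fun x hx => ⟨convexHull_mono (image_mono fun B hB => hB.1) hx, ?_⟩) ?_
  · have := le_of_mem_convexHull_image (coordSum S) (c := k)
      (fun B hB => by rw [coordSum_indicatorVector]; exact_mod_cast hB.2) hx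
    rwa [coordSum_apply] at this
  · rintro x ⟨hx, hxk⟩
    rw [basePolytope, hunion] at hx
    refine mem_convexHull_of_forall_mem_slice ?_ ?_
      (coordSum S) k ?_ ?_ ?_ hx (by rwa [coordSum_apply])
    · exact ⟨_, L, ⟨hL, hLk.le⟩, rfl⟩
    · exact ⟨_, U, ⟨hU, hUk.le⟩, rfl⟩
    · rintro _ ⟨B, hB, rfl⟩
      rw [coordSum_indicatorVector]; exact_mod_cast hB.2
    · rintro _ ⟨B, hB, rfl⟩
      rw [coordSum_indicatorVector]; exact_mod_cast hB.2
    · intro z hz hzk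
      rw [← hunion] at hz
      refine convexHull_mono (image_mono ?_)
        (mem_convexHull_of_coordSum_eq hL hLk hU hUk hz hzk)
      exact fun B hB => ⟨hB.1, hB.2.le⟩

theorem basePolytope_inter_ge_eq {n : ℕ} {M : Matroid (Fin n)} {S : Finset (Fin n)} {k : ℕ}
    {L U : Set (Fin n)} (hL : M.IsBase L) (hLk : (L ∩ S).ncard < k)
    (hU : M.IsBase U) (hUk : k < (U ∩ S).ncard) :
    convexHull ℝ (indicatorVector '' {B | M.IsBase B ∧ k ≤ (B ∩ S).ncard}) =
      basePolytope M ∩ {x | (k : ℝ) ≤ ∑ e ∈ S, x e} := by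
  have hunion : indicatorVector '' {B | M.IsBase B} =
      indicatorVector '' {B | M.IsBase B ∧ k ≤ (B ∩ S).ncard} ∪
      indicatorVector '' {B | M.IsBase B ∧ (B ∩ S).ncard ≤ k} := by
    rw [← image_union]
    congr 1
    ext B
    have := le_total (B ∩ (S : Set (Fin n))).ncard k
    simp only [mem_ofPred_eq, mem_union]
    tauto
  refine Subset.antisymm (fun x hx => ⟨convexHull_mono (image_mono fun B hB => hB.1) hx, ?_⟩) ?_
  · have := ge_of_mem_convexHull_image (coordSum S) (c := k)
      (fun B hB => by rw [coordSum_indicatorVector]; exact_mod_cast hB.2) hx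
    rwa [coordSum_apply] at this
  · rintro x ⟨hx, hxk⟩
    rw [basePolytope, hunion] at hx
    refine mem_convexHull_of_forall_mem_slice ?_ ?_
      -- Negation exchanges the two half-spaces.
      (-coordSum S) (-k) ?_ ?_ ?_ hx
      (by rw [LinearMap.neg_apply, coordSum_apply]; exact neg_le_neg hxk)
    · exact ⟨_, U, ⟨hU, hUk.le⟩, rfl⟩
    · exact ⟨_, L, ⟨hL, hLk.le⟩, rfl⟩
    · rintro _ ⟨B, hB, rfl⟩
      rw [LinearMap.neg_apply, coordSum_indicatorVector, neg_le_neg_iff]; exact_mod_cast hB.2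
    · rintro _ ⟨B, hB, rfl⟩
      rw [LinearMap.neg_apply, coordSum_indicatorVector, neg_le_neg_iff]; exact_mod_cast hB.2
    · intro z hz hzk
      rw [← hunion] at hz
      refine convexHull_mono (image_mono ?_)
        (mem_convexHull_of_coordSum_eq hL hLk hU hUk hz (neg_injective hzk))
      exact fun B hB => ⟨hB.1, hB.2.ge⟩

/-! ### Conditions (i) and (ii) in terms of bases -/

theorem Matroid.IsBase.ncard_inter_add_ncard_inter_compl {n r : ℕ} {M : Matroid (Fin n)}
    (hr : M.eRank = (r : ℕ∞)) {B : Set (Fin n)} (hB : M.IsBase B) (S : Set (Fin n)) :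
    (B ∩ S).ncard + (B ∩ Sᶜ).ncard = r := by
  have h : B.ncard = r := by
    have := hB.encard_eq_eRank
    rw [hr, ← (toFinite B).cast_ncard_eq] at this
    exact_mod_cast this
  rw [← sdiff_eq, ncard_inter_add_ncard_sdiff_eq_ncard, h]

theorem Matroid.exists_isBase_lt_ncard_inter_iff {n : ℕ} {M : Matroid (Fin n)} {S : Set (Fin n)}
    {k : ℕ} : (∃ B, M.IsBase B ∧ k < (B ∩ S).ncard) ↔ (k : ℕ∞) < M.eRk S := by
  constructor
  · rintro ⟨B, hB, hBk⟩
    refine lt_of_lt_of_le ?_ ((hB.indep.inter_right S).encard_le_eRk_of_subset inter_subset_right)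
    rw [← (toFinite (B ∩ S)).cast_ncard_eq]
    exact_mod_cast hBk
  · intro h
    obtain ⟨I, hI⟩ := M.exists_isBasis' S
    obtain ⟨B, hB, hIB⟩ := hI.indep.exists_isBase_superset
    refine ⟨B, hB, ?_⟩
    rw [← hI.encard_eq_eRk, ← (toFinite I).cast_ncard_eq] at h
    exact (show k < I.ncard by exact_mod_cast h).trans_le
      (ncard_le_ncard (subset_inter hIB hI.subset))

theorem Matroid.exists_isBase_ncard_inter_lt_iff {n r : ℕ} {M : Matroid (Fin n)}
    (hr : M.eRank = (r : ℕ∞)) {S : Set (Fin n)} {k : ℕ} :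
    (∃ B, M.IsBase B ∧ (B ∩ S).ncard < k) ↔ (r : ℕ∞) < M.eRk Sᶜ + k := by
  constructor
  · rintro ⟨B, hB, hBk⟩
    have h := hB.ncard_inter_add_ncard_inter_compl hr S
    refine lt_of_lt_of_le ?_ (add_le_add_left
      ((hB.indep.inter_right Sᶜ).encard_le_eRk_of_subset inter_subset_right) _)
    rw [← (toFinite (B ∩ Sᶜ)).cast_ncard_eq]
    have : r < (B ∩ Sᶜ).ncard + k := by omega
    exact_mod_cast this
  · intro h
    obtain ⟨I, hI⟩ := M.exists_isBasis' Sᶜ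
    obtain ⟨B, hB, hIB⟩ := hI.indep.exists_isBase_superset
    refine ⟨B, hB, ?_⟩
    rw [← hI.encard_eq_eRk, ← (toFinite I).cast_ncard_eq] at h
    have h' : r < I.ncard + k := by exact_mod_cast h
    have := ncard_le_ncard (subset_inter hIB hI.subset)
    have := hB.ncard_inter_add_ncard_inter_compl hr S
    omega

theorem indicatorVector_mem_basePolytope {n : ℕ} {M : Matroid (Fin n)} {B : Set (Fin n)} :
    indicatorVector B ∈ basePolytope M ↔ M.IsBase B :=
  ⟨mem_of_indicatorVector_mem_convexHull, fun h => subset_convexHull ℝ _ ⟨B, h, rfl⟩⟩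

/-- The bases that meet `S` in exactly `k` elements form a product. -/
def Matroid.IsProductAtLevel {n : ℕ} (M : Matroid (Fin n)) (S : Set (Fin n)) (k : ℕ) : Prop :=
  ∀ A B, M.IsBase A → M.IsBase B → (A ∩ S).ncard = k → (B ∩ S).ncard = k →
    M.IsBase (A ∩ S ∪ B \ S)

/-- The bases of an admissible minor are the sets outside S completing I to a base; equality of the
minors means that these do not depend on I. -/
theorem Matroid.isProductAtLevel_iff {n r k : ℕ} {M : Matroid (Fin n)}
    (hr : M.eRank = (r : ℕ∞)) {S : Set (Fin n)} :
    M.IsProductAtLevel S k ↔ ∀ I₁ I₂ : Set (Fin n),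
      M.Indep I₁ → I₁ ⊆ S → I₁.ncard = k → M.Indep I₂ → I₂ ⊆ S → I₂.ncard = k →
      ((M ／ I₁) ↾ Sᶜ).eRank + (k : ℕ∞) = (r : ℕ∞) →
      ((M ／ I₂) ↾ Sᶜ).eRank + (k : ℕ∞) = (r : ℕ∞) →
      (M ／ I₁) ↾ Sᶜ = (M ／ I₂) ↾ Sᶜ := by
  have henc : ∀ I : Set (Fin n), I.ncard = k → (k : ℕ∞) = I.encard := fun I h => by
    rw [← h, (toFinite I).cast_ncard_eq]
  have hsplit : ∀ I J : Set (Fin n), I ⊆ S → J ⊆ Sᶜ → (J ∪ I) ∩ S = I ∧ (J ∪ I) \ S = J := by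
    intro I J hI hJ
    constructor
    · ext e
      have := @hI e
      have := @hJ e
      simp only [mem_compl_iff, mem_inter_iff, mem_union] at *
      tauto
    · ext e
      have := @hI e
      have := @hJ e
      simp only [mem_compl_iff, mem_sdiff, mem_union] at *
      tauto
  constructor
  · intro hprod I₁ I₂ hI₁ hS₁ hk₁ hI₂ hS₂ hk₂ hr₁ hr₂
    rw [henc _ hk₁, ← hr] at hr₁
    rw [henc _ hk₂, ← hr] at hr₂
    have key : ∀ I I', M.Indep I → I ⊆ S → I.ncard = k →
        ((M ／ I) ↾ Sᶜ).eRank + I.encard = M.eRank → M.Indep I' → I' ⊆ S → I'.ncard = k →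
        ((M ／ I') ↾ Sᶜ).eRank + I'.encard = M.eRank → ∀ J, ((M ／ I) ↾ Sᶜ).IsBase J →
        ((M ／ I') ↾ Sᶜ).Indep J := by
      intro I I' hI hS hk hr hI' hS' hk' hr' J hJ
      obtain ⟨J', hJ'⟩ := ((M ／ I') ↾ Sᶜ).exists_isBase
      obtain ⟨hB, hJS⟩ := (restrict_contract_isBase_iff hI hS hr).1 hJ
      obtain ⟨hB', hJS'⟩ := (restrict_contract_isBase_iff hI' hS' hr').1 hJ'
      obtain ⟨h₁, h₂⟩ := hsplit I J hS hJS
      obtain ⟨h₁', h₂'⟩ := hsplit I' J' hS' hJS'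
      have := hprod _ _ hB' hB (by rw [h₁', hk']) (by rw [h₁, hk])
      rw [h₁', h₂, union_comm] at this
      exact (restrict_contract_indep_iff hI' hS').2 ⟨this.indep, hJS⟩
    exact ext_isBase_indep rfl (key I₁ I₂ hI₁ hS₁ hk₁ hr₁ hI₂ hS₂ hk₂ hr₂ · ·)
      (key I₂ I₁ hI₂ hS₂ hk₂ hr₂ hI₁ hS₁ hk₁ hr₁ · ·)
  · intro h A B hA hB hAk hBk
    have hrank : ∀ A, M.IsBase A → ((M ／ (A ∩ S)) ↾ Sᶜ).eRank + (A ∩ S).encard = M.eRank :=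
      fun A hA => IsBase.eRank_restrict_contract (J := A \ S) inter_subset_right
        (fun e he => he.2) (by rwa [union_comm, inter_union_sdiff])
    have heq := h (A ∩ S) (B ∩ S) (hA.indep.inter_right S) inter_subset_right hAk
      (hB.indep.inter_right S) inter_subset_right hBk
      (by rw [henc _ hAk, hrank A hA, hr]) (by rw [henc _ hBk, hrank B hB, hr])
    have hJ : ((M ／ (B ∩ S)) ↾ Sᶜ).IsBase (B \ S) :=
      (restrict_contract_isBase_iff (hB.indep.inter_right S) inter_subset_right (hrank B hB)).2
        ⟨by rwa [union_comm, inter_union_sdiff], fun e he => he.2⟩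
    rw [← heq] at hJ
    rw [union_comm]
    exact ((restrict_contract_isBase_iff (hA.indep.inter_right S) inter_subset_right
      (hrank A hA)).1 hJ).1

theorem Matroid.IsProductAtLevel.compl {n r k : ℕ} {M : Matroid (Fin n)}
    (hr : M.eRank = (r : ℕ∞)) {S : Set (Fin n)} (h : M.IsProductAtLevel S k) (hk : k ≤ r) :
    M.IsProductAtLevel Sᶜ (r - k) := by
  intro A B hA hB hAk hBk
  have hA' := hA.ncard_inter_add_ncard_inter_compl hr S
  have hB' := hB.ncard_inter_add_ncard_inter_compl hr S
  have := h B A hB hA (by omega) (by omega)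
  rwa [← sdiff_eq, sdiff_compl, union_comm]

/-- A matroid whose bases are the bases of `M` meeting `S` in at most `k` elements separates the
two parts of every base at level `k`. -/
theorem Matroid.isProductAtLevel_of_isBase_iff {n k : ℕ} {M N : Matroid (Fin n)}
    {S : Set (Fin n)} (hN : N.E = univ)
    (h : ∀ B, N.IsBase B ↔ M.IsBase B ∧ (B ∩ S).ncard ≤ k) : M.IsProductAtLevel S k := by
  intro A B hA hB hAk hBk
  have hA' : N.IsBase A := (h A).2 ⟨hA, hAk.le⟩
  have hB' : N.IsBase B := (h B).2 ⟨hB, hBk.le⟩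
  -- No base of N meets S in more than k elements, so A ∩ S is already maximal in S and can replace
  -- B ∩ S in spanning N.
  have hbasis : N.IsBasis (A ∩ S) S := by
    obtain ⟨I, hI, hAI⟩ := (hA'.indep.inter_right S).subset_isBasis_of_subset inter_subset_right
      (hN ▸ subset_univ S)
    obtain ⟨C, hC, hIC⟩ := hI.exists_isBase
    have hCk := ((h C).1 hC).2
    rw [← hIC, ← hAk] at hCk
    rwa [eq_of_subset_of_ncard_le hAI hCk]
  have hspan : N.closure (A ∩ S ∪ B \ S) = N.E := by
    rw [← N.closure_union_closure_left_eq, hbasis.closure_eq_closure,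
      N.closure_union_closure_left_eq]
    exact hB'.closure_of_superset fun e he => by
      by_cases hS : e ∈ S
      · exact Or.inl hS
      · exact Or.inr ⟨he, hS⟩
  have hsp : N.Spanning (A ∩ S ∪ B \ S) := ⟨hspan, hN ▸ subset_univ _⟩
  obtain ⟨C, hC, hCsub⟩ := hsp.exists_isBase_subset
  have hcard := hC.ncard_eq_ncard_of_isBase hB'
  have h₁ : (A ∩ S ∪ B \ S).ncard ≤ B.ncard := by
    rw [← ncard_inter_add_ncard_sdiff_eq_ncard B S, hBk, ← hAk]
    exact ncard_union_le _ _
  rw [eq_of_subset_of_ncard_le hCsub (h₁.trans hcard.ge)] at hC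
  exact ((h _).1 hC).1

/-! ### The two directions of the equivalence -/

theorem GivesHyperplaneSplit.isProductAtLevel {n k : ℕ} {M : Matroid (Fin n)}
    {S : Finset (Fin n)} (h : GivesHyperplaneSplit M S k) : M.IsProductAtLevel S k := by
  obtain ⟨M₁, M₂, hs, h₁, -⟩ := h
  refine Matroid.isProductAtLevel_of_isBase_iff hs.ground_left fun B => ?_
  rw [← indicatorVector_mem_basePolytope, h₁, ← indicatorVector_mem_basePolytope, mem_inter_iff,
    mem_ofPred_eq, ← coordSum_apply, coordSum_indicatorVector, Nat.cast_le]

/-- Otherwise Q(M₁) lies inside Q(M₂), and the common face is not proper. -/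
theorem GivesHyperplaneSplit.exists_isBase_lt {n k : ℕ} {M : Matroid (Fin n)}
    {S : Finset (Fin n)} (h : GivesHyperplaneSplit M S k) :
    ∃ B, M.IsBase B ∧ (B ∩ S).ncard < k := by
  obtain ⟨M₁, M₂, hs, h₁, h₂⟩ := h
  by_contra! hall
  refine hs.face_left.2 (inter_eq_left.2 fun x hx => ?_)
  rw [h₁] at hx
  rw [h₂]
  refine ⟨hx.1, ?_⟩
  have := ge_of_mem_convexHull_image (coordSum S) (c := k)
    (fun B hB => by rw [coordSum_indicatorVector]; exact_mod_cast hall B hB) hx.1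
  rwa [coordSum_apply] at this

theorem GivesHyperplaneSplit.exists_isBase_gt {n k : ℕ} {M : Matroid (Fin n)}
    {S : Finset (Fin n)} (h : GivesHyperplaneSplit M S k) :
    ∃ B, M.IsBase B ∧ k < (B ∩ S).ncard := by
  obtain ⟨M₁, M₂, hs, h₁, h₂⟩ := h
  by_contra! hall
  refine hs.face_right.2 (inter_eq_right.2 fun x hx => ?_)
  rw [h₂] at hx
  rw [h₁]
  refine ⟨hx.1, ?_⟩
  have := le_of_mem_convexHull_image (coordSum S) (c := k)
    (fun B hB => by rw [coordSum_indicatorVector]; exact_mod_cast hall B hB) hx.1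
  rwa [coordSum_apply] at this

theorem givesHyperplaneSplit_of_isProductAtLevel {n r k : ℕ} {M : Matroid (Fin n)}
    (hr : M.eRank = (r : ℕ∞)) {S : Finset (Fin n)} (hprod : M.IsProductAtLevel S k)
    (hlow : ∃ B, M.IsBase B ∧ (B ∩ S).ncard < k) (hupp : ∃ B, M.IsBase B ∧ k < (B ∩ S).ncard) :
    GivesHyperplaneSplit M S k := by
  obtain ⟨L, hL, hLk⟩ := hlow
  obtain ⟨U, hU, hUk⟩ := hupp
  have hkr : k ≤ r := by
    have := hU.ncard_inter_add_ncard_inter_compl hr S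
    omega
  have hcompl : ∀ B, (M.IsBase B ∧ (B ∩ (S : Set (Fin n))ᶜ).ncard ≤ r - k) ↔
      (M.IsBase B ∧ k ≤ (B ∩ S).ncard) := fun B => and_congr_right fun hB => by
    have := hB.ncard_inter_add_ncard_inter_compl hr S
    omega
  let M₁ : Matroid (Fin n) := Matroid.ofIsBaseOfFinite finite_univ
    (fun B => M.IsBase B ∧ (B ∩ S).ncard ≤ k) ⟨L, hL, hLk.le⟩
    (Matroid.exchangeProperty_ncard_inter_le hprod) fun B _ => subset_univ B
  -- The upper side is the lower side for Sᶜ at level r - k.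
  let M₂ : Matroid (Fin n) := Matroid.ofIsBaseOfFinite finite_univ
    (fun B => M.IsBase B ∧ (B ∩ (S : Set (Fin n))ᶜ).ncard ≤ r - k) ⟨U, (hcompl U).2 ⟨hU, hUk.le⟩⟩
    (Matroid.exchangeProperty_ncard_inter_le (hprod.compl hr hkr)) fun B _ => subset_univ B
  have h₁ : basePolytope M₁ = basePolytope M ∩ {x | ∑ e ∈ S, x e ≤ (k : ℝ)} :=
    basePolytope_inter_le_eq hL hLk hU hUk
  have h₂ : basePolytope M₂ = basePolytope M ∩ {x | (k : ℝ) ≤ ∑ e ∈ S, x e} := by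
    rw [← basePolytope_inter_ge_eq hL hLk hU hUk]
    exact congrArg (fun s => convexHull ℝ (indicatorVector '' s)) (Set.ext hcompl)
  -- Zero weight: only a level-k base is wanted. It shows that the extreme value of the coordinate
  -- sum on each piece is k, so the exposed face is the slice.
  obtain ⟨C, hC, hCk, -⟩ := Matroid.exists_isBase_ncard_inter_eq
    (exchangeModular_indicatorVector 0) hU hL hUk.le hLk.le
  have hCM : indicatorVector C ∈ basePolytope M := indicatorVector_mem_basePolytope.2 hC
  have hCS : coordSum S (indicatorVector C) = k := by rw [coordSum_indicatorVector, hCk]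
  have hCS' : ∑ e ∈ S, indicatorVector C e = k := by rw [← coordSum_apply, hCS]
  have hLS : ∑ e ∈ S, indicatorVector L e < (k : ℝ) := by
    rw [← coordSum_apply, coordSum_indicatorVector]; exact_mod_cast hLk
  have hUS : (k : ℝ) < ∑ e ∈ S, indicatorVector U e := by
    rw [← coordSum_apply, coordSum_indicatorVector]; exact_mod_cast hUk
  refine ⟨M₁, M₂, ⟨rfl, rfl, ?_, ⟨fun _ => ⟨(coordSum S).toContinuousLinearMap, ?_⟩, ?_⟩,
    ⟨fun _ => ⟨-(coordSum S).toContinuousLinearMap, ?_⟩, ?_⟩⟩, h₁, h₂⟩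
  · rw [h₁, h₂, ← inter_union_distrib_left]
    exact (inter_eq_left.2 fun x _ => le_total (∑ e ∈ S, x e) (k : ℝ)).symm
  · ext x
    simp only [h₁, h₂, mem_inter_iff, mem_ofPred_eq, LinearMap.coe_toContinuousLinearMap',
      coordSum_apply]
    refine ⟨fun h => ⟨h.1, fun y hy => hy.2.trans h.2.2⟩, fun h => ⟨h.1, h.1.1, ?_⟩⟩
    exact hCS'.ge.trans (h.2 _ ⟨hCM, hCS'.le⟩)
  · intro h
    have : indicatorVector L ∈ basePolytope M₁ :=
      h₁ ▸ ⟨indicatorVector_mem_basePolytope.2 hL, hLS.le⟩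
    rw [← h, h₂] at this
    exact hLS.not_ge this.2.2
  · ext x
    simp only [h₁, h₂, mem_inter_iff, mem_ofPred_eq, neg_apply,
      LinearMap.coe_toContinuousLinearMap', coordSum_apply, neg_le_neg_iff]
    refine ⟨fun h => ⟨h.2, fun y hy => h.1.2.trans hy.2⟩, fun h => ⟨⟨h.1.1, ?_⟩, h.1⟩⟩
    exact (h.2 _ ⟨hCM, hCS'.ge⟩).trans hCS'.le
  · intro h
    have : indicatorVector U ∈ basePolytope M₂ :=
      h₂ ▸ ⟨indicatorVector_mem_basePolytope.2 hU, hUS.le⟩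
    rw [← h, h₁] at this
    exact hUS.not_ge this.1.2

theorem mainTheorem2 (n r k : ℕ) (M : Matroid (Fin n)) (hE : M.E = Set.univ)
    (hr : M.eRank = (r : ℕ∞)) (S : Finset (Fin n)) :
    GivesHyperplaneSplit M S k ↔
      (((k : ℕ∞) < M.eRk (S : Set (Fin n)) ∧
          (r : ℕ∞) < M.eRk (S : Set (Fin n))ᶜ + (k : ℕ∞)) ∧
        ∀ I₁ I₂ : Set (Fin n),
          M.Indep I₁ → I₁ ⊆ (S : Set (Fin n)) → I₁.ncard = k →
          M.Indep I₂ → I₂ ⊆ (S : Set (Fin n)) → I₂.ncard = k →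
          ((M ／ I₁) ↾ (S : Set (Fin n))ᶜ).eRank + (k : ℕ∞) = (r : ℕ∞) →
          ((M ／ I₂) ↾ (S : Set (Fin n))ᶜ).eRank + (k : ℕ∞) = (r : ℕ∞) →
          (M ／ I₁) ↾ (S : Set (Fin n))ᶜ = (M ／ I₂) ↾ (S : Set (Fin n))ᶜ) := by
  rw [← Matroid.isProductAtLevel_iff hr, ← Matroid.exists_isBase_lt_ncard_inter_iff,
    ← Matroid.exists_isBase_ncard_inter_lt_iff hr]
  exact ⟨fun h => ⟨⟨h.exists_isBase_gt, h.exists_isBase_lt⟩, h.isProductAtLevel⟩,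
    fun h => givesHyperplaneSplit_of_isProductAtLevel hr h.2 h.1.2 h.1.1⟩
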